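/- Let $\mathbb{T}$ be the unit circle with normalized arc-length measure $m$, and let $\widehat f(n)=\int_{\mathbb{T}} f(\zeta)\,\overline{\zeta}^{\,n}\,dm(\zeta)$ for $n\in\mathbb{Z}$. Let $(\lambda_n)_{n\ge 0}$ be positive real numbers such that (i) $\sum_{n} \frac{1}{\lambda_n}=+\infty$, and (ii) there exists $C>1$ such that, for all $n\ge 1$, $C^{-1}\lambda_n\le \lambda_k\le C\lambda_n$ whenever $n\le k\le 2n$. Then there exists a positive function $f\in L^\infty(\mathbb{T},dm)$, that is, $f\ge 0$ $m$-almost everywhere and $f$ is not $m$-almost everywhere zero, such that the (closed) support of the measure $f\,dm$ has empty interior, but $$\sum_{n\in\mathbb{Z}} |\widehat f(n)|^2\,\lambda_{|n|}<\infty .$$ -/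

import Mathlib

open MeasureTheory AddCircle
open scoped ENNReal

/-!
The function is built by cutting out
neighbourhoods of the points of a dense sequence, starting from the constant `1`. Two facts make
each cut arbitrarily cheap in the weighted energy `∑ |f̂(n)|² λ_|n|`.

* Points have zero capacity (`exists_cutoff_energy_le`). Let `φ` be a smooth bump on the circle with
  values in `[0, 1]`, equal to `1` near `0` and of small mean, and let `h` be the average of the
  dilates `φ(n (x - q))`, `1 ≤ n ≤ N`, with weights proportional to `1 / λ_n`. An average of numbers
  in `[0, 1]` lies in `[0, 1]`, and `h = 1` near `q` because all the dilates are `1` there. For a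
  fixed `d ≠ 0`, the terms `φ̂(d)` of the different dilates sit at the distinct frequencies `d n`,
  where the weight is at most `K (1 + |d|)^A λ_n` by the doubling condition. Their energy is
  therefore at most a constant times `1 / ∑_{n ≤ N} 1 / λ_n`, with a power of `d` absorbed by the
  decay of `φ̂` (`CircleSmooth.energy_sum_dilate_le`). It tends to `0` as `N → ∞`; the remaining
  frequency `0` only carries the mean of `φ`.

* Multiplication by a fixed smooth function is bounded for the weighted energy
  (`CircleSmooth.exists_energy_mul_le`). Hence replacing a smooth `f ≥ 0` by `f (1 - h)` changes
  it by `f h`, whose energy is as small as desired once `f` is known.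

The resulting sequence of smooth functions decreases to a limit `f` with `0 ≤ f ≤ 1`, vanishing near
each point of the dense sequence, so that the support of `f` has empty interior. The energy of `1 - f` is finite by Minkowski's inequality, and
smaller than `λ_0`, which keeps the mean of `f` away from `0`.
-/

open Filter Topology

/-! ### Smooth functions on the circle and their Fourier series -/

/-- A function on the circle is smooth if its `1`-periodic lift to the real line is `C^∞`. -/
def CircleSmooth (f : UnitAddCircle → ℂ) : Prop :=
  ContDiff ℝ (⊤ : ℕ∞) (fun t : ℝ => f (t : UnitAddCircle))

lemma CircleSmooth.continuous {f : UnitAddCircle → ℂ} (hf : CircleSmooth f) : Continuous f :=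
  continuous_coinduced_dom.2 (ContDiff.continuous hf)

lemma CircleSmooth.mul {f g : UnitAddCircle → ℂ} (hf : CircleSmooth f) (hg : CircleSmooth g) :
    CircleSmooth (fun x => f x * g x) :=
  ContDiff.mul hf hg

lemma Continuous.exists_norm_le_circle {f : UnitAddCircle → ℂ} (hf : Continuous f) :
    ∃ M : ℝ, ∀ x, ‖f x‖ ≤ M := by
  obtain ⟨M, hM⟩ := isCompact_univ.exists_bound_of_continuousOn hf.continuousOn
  exact ⟨M, fun x => hM x (Set.mem_univ x)⟩

lemma Continuous.integrable_circle {f : UnitAddCircle → ℂ} (hf : Continuous f) :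
    Integrable f haarAddCircle := by
  obtain ⟨M, hM⟩ := hf.exists_norm_le_circle
  exact Integrable.of_bound hf.aestronglyMeasurable M (ae_of_all _ hM)

lemma norm_fourier_apply (n : ℤ) (x : UnitAddCircle) : ‖fourier n x‖ = 1 := by
  rw [fourier_apply]
  exact Circle.norm_coe _

lemma norm_fourierCoeff_le {f : UnitAddCircle → ℂ} {M : ℝ} (hM : ∀ x, ‖f x‖ ≤ M) (n : ℤ) :
    ‖fourierCoeff f n‖ ≤ M := by
  have h := norm_integral_le_of_norm_le_const (μ := (haarAddCircle : Measure UnitAddCircle))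
    (f := fun x => fourier (-n) x • f x) (C := M)
    (ae_of_all _ fun x => by rw [norm_smul, norm_fourier_apply, one_mul]; exact hM x)
  simpa [fourierCoeff] using h

/-- Integration by parts over one period: the Fourier coefficients of the derivative. -/
lemma CircleSmooth.exists_deriv {f : UnitAddCircle → ℂ} (hf : CircleSmooth f) :
    ∃ g : UnitAddCircle → ℂ, CircleSmooth g ∧
      ∀ n : ℤ, fourierCoeff g n = 2 * Real.pi * Complex.I * n * fourierCoeff f n := by
  set F : ℝ → ℂ := fun t => f (t : UnitAddCircle) with hF
  have hFp : Function.Periodic F 1 := fun t => by simp [hF]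
  have hdp : Function.Periodic (deriv F) 1 := fun t => by
    rw [← deriv_comp_add_const, funext hFp]
  obtain ⟨hdiff, hsm⟩ := contDiff_infty_iff_deriv.1 hf
  have hlift : ∀ t : ℝ, hdp.lift (t : UnitAddCircle) = deriv F t := fun t => rfl
  refine ⟨hdp.lift, by simpa only [CircleSmooth, hlift] using hsm, fun n => ?_⟩
  have hft : ∀ x : ℝ, HasDerivAt (fun y : ℝ => fourier (-n) (y : UnitAddCircle))
      (-2 * Real.pi * Complex.I * n * fourier (-n) (x : UnitAddCircle)) x := fun x => by
    simpa using hasDerivAt_fourier_neg 1 n x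
  have hcf : Continuous fun y : ℝ => fourier (-n) (y : UnitAddCircle) :=
    continuous_iff_continuousAt.2 fun x => (hft x).continuousAt
  have hcF : Continuous F := ContDiff.continuous hf
  have hcd : Continuous (deriv F) := ContDiff.continuous hsm
  have hd : ∀ x : ℝ, HasDerivAt (fun y : ℝ => fourier (-n) (y : UnitAddCircle) * F y)
      (-2 * Real.pi * Complex.I * n * fourier (-n) (x : UnitAddCircle) * F x +
        fourier (-n) (x : UnitAddCircle) * deriv F x) x :=
    fun x => (hft x).mul (hdiff x).hasDerivAt
  have hi₁ : Continuous fun x : ℝ =>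
      -2 * Real.pi * Complex.I * n * fourier (-n) (x : UnitAddCircle) * F x :=
    (continuous_const.mul hcf).mul hcF
  have hi₂ : Continuous fun x : ℝ => fourier (-n) (x : UnitAddCircle) * deriv F x :=
    hcf.mul hcd
  have key := intervalIntegral.integral_eq_sub_of_hasDerivAt (a := 0) (b := 1)
    (fun x _ => hd x) ((hi₁.add hi₂).intervalIntegrable 0 1)
  rw [intervalIntegral.integral_add (hi₁.intervalIntegrable 0 1) (hi₂.intervalIntegrable 0 1)]
    at key
  have hper : F 1 = F 0 := by simpa using hFp 0
  have hone : ((1 : ℝ) : UnitAddCircle) = ((0 : ℝ) : UnitAddCircle) := by simp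
  simp only [hper, hone, sub_self, mul_assoc,
    intervalIntegral.integral_const_mul] at key
  rw [fourierCoeff_eq_intervalIntegral _ n 0, fourierCoeff_eq_intervalIntegral _ n 0]
  simp only [zero_add, div_one, one_smul, smul_eq_mul, hlift]
  linear_combination key

/-- The Fourier coefficients of a smooth function decay faster than any power. -/
lemma CircleSmooth.exists_decay (k : ℕ) : ∀ {f : UnitAddCircle → ℂ}, CircleSmooth f →
    ∃ M : ℝ, ∀ n : ℤ, |(n : ℝ)| ^ k * ‖fourierCoeff f n‖ ≤ M := by
  induction k with
  | zero =>
    intro f hf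
    obtain ⟨M, hM⟩ := hf.continuous.exists_norm_le_circle
    exact ⟨M, fun n => by simpa using norm_fourierCoeff_le hM n⟩
  | succ k ih =>
    intro f hf
    obtain ⟨g, hg, hgf⟩ := hf.exists_deriv
    obtain ⟨M, hM⟩ := ih hg
    refine ⟨M, fun n => le_trans ?_ (hM n)⟩
    have h2 : ‖fourierCoeff g n‖ = 2 * Real.pi * |(n : ℝ)| * ‖fourierCoeff f n‖ := by
      rw [hgf n]
      simp [abs_of_pos Real.pi_pos]
    have hpi : 1 ≤ 2 * Real.pi := by linarith [Real.pi_gt_three]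
    have h0 : 0 ≤ |(n : ℝ)| ^ k * (|(n : ℝ)| * ‖fourierCoeff f n‖) := by positivity
    rw [h2]
    calc |(n : ℝ)| ^ (k + 1) * ‖fourierCoeff f n‖
        = 1 * (|(n : ℝ)| ^ k * (|(n : ℝ)| * ‖fourierCoeff f n‖)) := by ring
      _ ≤ 2 * Real.pi * (|(n : ℝ)| ^ k * (|(n : ℝ)| * ‖fourierCoeff f n‖)) := by gcongr
      _ = _ := by ring

lemma CircleSmooth.summable_weighted {f : UnitAddCircle → ℂ} (hf : CircleSmooth f) (k : ℕ) :
    Summable fun n : ℤ => ‖fourierCoeff f n‖ * (1 + (n.natAbs : ℝ)) ^ k := by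
  obtain ⟨M, hM⟩ := hf.exists_decay (k + 2)
  refine Summable.of_norm_bounded_eventually
    ((Real.summable_one_div_int_pow (p := 2)).2 (by norm_num) |>.mul_left (2 ^ k * M)) ?_
  filter_upwards [(Set.finite_singleton (0 : ℤ)).compl_mem_cofinite] with n hn
  have hn0 : n ≠ 0 := by simpa using hn
  have hn1 : (1 : ℝ) ≤ |(n : ℝ)| := by
    exact_mod_cast Int.one_le_abs hn0
  have hcast : (n.natAbs : ℝ) = |(n : ℝ)| := Nat.cast_natAbs n |>.trans (by push_cast; rfl)
  have hpow : (1 + |(n : ℝ)|) ^ k ≤ 2 ^ k * |(n : ℝ)| ^ k := by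
    rw [← mul_pow]
    exact pow_le_pow_left₀ (by positivity) (by linarith) k
  rw [Real.norm_of_nonneg (by positivity), hcast, ← sq_abs (n : ℝ), mul_one_div,
    le_div_iff₀ (by positivity)]
  calc ‖fourierCoeff f n‖ * (1 + |(n : ℝ)|) ^ k * |(n : ℝ)| ^ 2
      ≤ ‖fourierCoeff f n‖ * (2 ^ k * |(n : ℝ)| ^ k) * |(n : ℝ)| ^ 2 := by gcongr
    _ = 2 ^ k * (|(n : ℝ)| ^ (k + 2) * ‖fourierCoeff f n‖) := by ring
    _ ≤ 2 ^ k * M := by gcongr; exact hM n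

lemma CircleSmooth.summable {f : UnitAddCircle → ℂ} (hf : CircleSmooth f) :
    Summable fun n : ℤ => ‖fourierCoeff f n‖ := by
  simpa using hf.summable_weighted 0

lemma CircleSmooth.tsum_weighted_ne_top {f : UnitAddCircle → ℂ} (hf : CircleSmooth f) (k : ℕ) :
    ∑' n : ℤ, ‖fourierCoeff f n‖ₑ * (1 + (n.natAbs : ℝ≥0∞)) ^ k ≠ ∞ := by
  have h := (hf.summable_weighted k).tsum_ofReal_ne_top
  convert h using 3 with n
  rw [ENNReal.ofReal_mul (norm_nonneg _), ofReal_norm, ENNReal.ofReal_pow (by positivity),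
    ENNReal.ofReal_add zero_le_one (by positivity), ENNReal.ofReal_one, ENNReal.ofReal_natCast]

lemma CircleSmooth.hasSum {f : UnitAddCircle → ℂ} (hf : CircleSmooth f) (x : UnitAddCircle) :
    HasSum (fun n : ℤ => fourierCoeff f n * fourier n x) (f x) := by
  simpa using has_pointwise_sum_fourier_series_of_summable
    (f := ⟨f, hf.continuous⟩) hf.summable.of_norm x

/-- If `f = ∑ a_i u_i` with `∑ |a_i| < ∞` and uniformly bounded `u_i`, the Fourier coefficients may
be computed term by term, and the triangle inequality applies. -/
lemma enorm_fourierCoeff_le_tsum {ι : Type*} [Countable ι] {f : UnitAddCircle → ℂ}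
    {a : ι → ℂ} {u : ι → UnitAddCircle → ℂ} {M : ℝ} (ha : Summable fun i => ‖a i‖)
    (hu : ∀ i, Continuous (u i)) (huM : ∀ i x, ‖u i x‖ ≤ M)
    (hsum : ∀ x, HasSum (fun i => a i * u i x) (f x)) (n : ℤ) :
    ‖fourierCoeff f n‖ₑ ≤ ∑' i, ‖a i‖ₑ * ‖fourierCoeff (u i) n‖ₑ := by
  have key : HasSum (fun i => ∫ x, fourier (-n) x • (a i * u i x) ∂haarAddCircle)
      (fourierCoeff f n) := by
    refine hasSum_integral_of_dominated_convergence (fun i _ => ‖a i‖ * M) (fun i => ?_)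
      (fun i => ae_of_all _ fun x => ?_) (ae_of_all _ fun _ => ha.mul_right M)
      (integrable_const _) (ae_of_all _ fun x => ?_)
    · exact ((map_continuous (fourier (-n))).smul
        (continuous_const.mul (hu i))).aestronglyMeasurable
    · rw [norm_smul, norm_fourier_apply, one_mul, norm_mul]
      exact mul_le_mul_of_nonneg_left (huM i x) (norm_nonneg _)
    · exact (hsum x).const_smul _
  rw [← key.tsum_eq]
  refine enorm_tsum_le_tsum_enorm.trans (ENNReal.tsum_le_tsum fun i => ?_)
  change ‖fourierCoeff (fun x => a i * u i x) n‖ₑ ≤ _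
  rw [fourierCoeff.const_mul, enorm_mul]

/-! ### The Cauchy–Schwarz inequality with weights -/

lemma ENNReal.two_mul_mul_le_sq_add_sq (a b : ℝ≥0∞) : 2 * (a * b) ≤ a ^ 2 + b ^ 2 := by
  induction a with
  | top => simp
  | coe a =>
    induction b with
    | top => simp
    | coe b =>
      norm_cast
      rw [← mul_assoc]
      exact two_mul_le_add_sq a b

/-- The Cauchy–Schwarz inequality for series, with weights `p`. -/
lemma ENNReal.tsum_mul_sq_le {ι : Type*} (p u : ι → ℝ≥0∞) :
    (∑' i, p i * u i) ^ 2 ≤ (∑' i, p i) * ∑' i, p i * u i ^ 2 := by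
  have h : 2 * (∑' i, p i * u i) ^ 2 ≤ 2 * ((∑' i, p i) * ∑' i, p i * u i ^ 2) := by
    calc 2 * (∑' i, p i * u i) ^ 2
        = ∑' i, ∑' j, p i * p j * (2 * (u i * u j)) := by
          rw [sq, ← ENNReal.tsum_mul_right, ← ENNReal.tsum_mul_left]
          refine tsum_congr fun i => ?_
          rw [← ENNReal.tsum_mul_left, ← ENNReal.tsum_mul_left]
          exact tsum_congr fun j => by ring
      _ ≤ ∑' i, ∑' j, (p i * (p j * u j ^ 2) + p i * u i ^ 2 * p j) := by
          refine ENNReal.tsum_le_tsum fun i => ENNReal.tsum_le_tsum fun j => ?_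
          calc p i * p j * (2 * (u i * u j)) ≤ p i * p j * (u i ^ 2 + u j ^ 2) := by
                gcongr
                exact ENNReal.two_mul_mul_le_sq_add_sq _ _
            _ = _ := by ring
      _ = 2 * ((∑' i, p i) * ∑' i, p i * u i ^ 2) := by
          simp only [ENNReal.tsum_add, ENNReal.tsum_mul_left, ENNReal.tsum_mul_right]
          ring
  exact (ENNReal.mul_le_mul_iff_right (by norm_num) (by norm_num)).1 h

/-! ### Weights of moderate growth -/

/-- Iterating the doubling condition `j` times costs at most a factor `C ^ j`. -/
lemma doubling_iterate {lam : ℕ → ℝ} (hpos : ∀ n, 0 < lam n) {C : ℝ} (hC : 1 < C)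
    (h : ∀ n : ℕ, 1 ≤ n → ∀ k : ℕ, n ≤ k → k ≤ 2 * n →
      C⁻¹ * lam n ≤ lam k ∧ lam k ≤ C * lam n) (j : ℕ) {a b : ℕ} (ha : 1 ≤ a) (hab : a ≤ b)
    (hb : b ≤ 2 ^ j * a) : lam b ≤ C ^ j * lam a ∧ lam a ≤ C ^ j * lam b := by
  have hC0 : 0 < C := by linarith
  induction j generalizing b with
  | zero =>
    obtain rfl : a = b := by omega
    simp
  | succ j ih =>
    rcases le_total b (2 ^ j * a) with hbj | hbj
    · obtain ⟨h1, h2⟩ := ih hab hbj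
      have hmono : C ^ j ≤ C ^ (j + 1) := pow_le_pow_right₀ hC.le (Nat.le_succ j)
      exact ⟨h1.trans (mul_le_mul_of_nonneg_right hmono (hpos a).le),
        h2.trans (mul_le_mul_of_nonneg_right hmono (hpos b).le)⟩
    · have hac : a ≤ 2 ^ j * a := Nat.le_mul_of_pos_left a (by positivity)
      obtain ⟨h1, h2⟩ := ih hac le_rfl
      obtain ⟨h3, h4⟩ := h (2 ^ j * a) (ha.trans hac) b hbj (by rw [pow_succ] at hb; linarith)
      rw [inv_mul_le_iff₀ hC0] at h3
      refine ⟨h4.trans ?_, h2.trans ?_⟩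
      · rw [pow_succ', mul_assoc]
        exact mul_le_mul_of_nonneg_left h1 hC0.le
      · rw [pow_succ, mul_assoc]
        exact mul_le_mul_of_nonneg_left h3 (by positivity)

/-- A weight on `ℤ` has moderate growth if it changes by at most a factor `K * s ^ A` between two
frequencies whose absolute values, with `0` counted as `1`, have ratio between `1 / s` and `s`. -/
def ModerateGrowth (w : ℤ → ℝ≥0∞) (K : ℝ≥0∞) (A : ℕ) : Prop :=
  ∀ (a b : ℤ) (s : ℕ), 1 ≤ s → max b.natAbs 1 ≤ s * max a.natAbs 1 →
    max a.natAbs 1 ≤ s * max b.natAbs 1 → w b ≤ K * (s : ℝ≥0∞) ^ A * w a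

lemma ModerateGrowth.add_le {w : ℤ → ℝ≥0∞} {K : ℝ≥0∞} {A : ℕ} (hw : ModerateGrowth w K A)
    (n m : ℤ) : w (n + m) ≤ K * (1 + (m.natAbs : ℝ≥0∞)) ^ A * w n := by
  have h := hw n (n + m) (1 + m.natAbs) (by omega) ?_ ?_
  · simpa using h
  · have : (n + m).natAbs ≤ n.natAbs + m.natAbs := Int.natAbs_add_le n m
    have h1 : m.natAbs * 1 ≤ m.natAbs * max n.natAbs 1 := Nat.mul_le_mul_left _ (le_max_right _ _)
    rw [add_mul, one_mul]
    omega
  · have : n.natAbs ≤ (n + m).natAbs + m.natAbs := by omega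
    have h1 : m.natAbs * 1 ≤ m.natAbs * max (n + m).natAbs 1 :=
      Nat.mul_le_mul_left _ (le_max_right _ _)
    rw [add_mul, one_mul]
    omega

lemma ModerateGrowth.mul_le {w : ℤ → ℝ≥0∞} {K : ℝ≥0∞} {A : ℕ} (hw : ModerateGrowth w K A)
    {d n : ℤ} (hd : d ≠ 0) (hn : n ≠ 0) :
    w (d * n) ≤ K * (1 + (d.natAbs : ℝ≥0∞)) ^ A * w n := by
  have h := hw n (d * n) (1 + d.natAbs) (by omega) ?_ ?_
  · simpa using h
  all_goals
    have hn1 : 1 ≤ n.natAbs := Int.natAbs_pos.2 hn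
    have hd1 : 1 ≤ d.natAbs := Int.natAbs_pos.2 hd
    have h1 : 1 * n.natAbs ≤ d.natAbs * n.natAbs := Nat.mul_le_mul_right _ hd1
    rw [Int.natAbs_mul, max_eq_left hn1, max_eq_left (by omega)]
    nlinarith

/-- A doubling sequence, extended evenly to `ℤ`, has moderate growth. -/
lemma exists_moderateGrowth {lam : ℕ → ℝ} (hpos : ∀ n, 0 < lam n)
    (hdoubling : ∃ C : ℝ, 1 < C ∧ ∀ n : ℕ, 1 ≤ n → ∀ k : ℕ, n ≤ k → k ≤ 2 * n →
      C⁻¹ * lam n ≤ lam k ∧ lam k ≤ C * lam n) :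
    ∃ (K : ℝ≥0∞) (A : ℕ), K ≠ ∞ ∧
      ModerateGrowth (fun n => ENNReal.ofReal (lam n.natAbs)) K A := by
  obtain ⟨C, hC, h⟩ := hdoubling
  obtain ⟨A, hA⟩ := pow_unbounded_of_one_lt C (one_lt_two : (1 : ℝ) < 2)
  -- frequencies at least `1`
  have hmain : ∀ a b s : ℕ, 1 ≤ a → 1 ≤ b → 1 ≤ s → b ≤ s * a → a ≤ s * b →
      lam b ≤ (2 * s) ^ A * lam a := by
    intro a b s ha hb hs hba hab
    set j := Nat.log 2 s + 1
    have hsj : s ≤ 2 ^ j := (Nat.lt_pow_succ_log_self one_lt_two s).le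
    have hjs : (2 : ℝ) ^ j ≤ 2 * s := by
      have := Nat.pow_log_le_self 2 (by omega : s ≠ 0)
      have h3 : 2 ^ j ≤ 2 * s := by simp only [j, pow_succ]; omega
      exact_mod_cast h3
    have hpow : C ^ j ≤ (2 * (s : ℝ)) ^ A :=
      calc C ^ j ≤ (2 ^ A) ^ j := pow_le_pow_left₀ (by linarith) hA.le j
        _ = (2 ^ j) ^ A := by rw [← pow_mul, ← pow_mul, mul_comm]
        _ ≤ _ := pow_le_pow_left₀ (by positivity) hjs A
    have hb' : lam b ≤ C ^ j * lam a := by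
      rcases le_total a b with hle | hle
      · exact (doubling_iterate hpos hC h j ha hle (hba.trans (Nat.mul_le_mul_right a hsj))).1
      · exact (doubling_iterate hpos hC h j hb hle (hab.trans (Nat.mul_le_mul_right b hsj))).2
    exact hb'.trans (mul_le_mul_of_nonneg_right hpow (hpos a).le)
  -- the frequency `0` is compared with `1`
  obtain ⟨C₀, hC₀, hup, hdown⟩ : ∃ C₀ : ℝ, 0 < C₀ ∧ (∀ a, lam a ≤ C₀ * lam (max a 1)) ∧
      ∀ a, lam (max a 1) ≤ C₀ * lam a := by
    have h0 := hpos 0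
    have h1 := hpos 1
    have p1 : 0 < lam 0 / lam 1 := by positivity
    have p2 : 0 < lam 1 / lam 0 := by positivity
    refine ⟨1 + lam 0 / lam 1 + lam 1 / lam 0, by positivity, fun a => ?_, fun a => ?_⟩
    all_goals
      rcases Nat.eq_zero_or_pos a with rfl | ha
      · have e1 : lam 0 / lam 1 * lam 1 = lam 0 := by field_simp
        have e2 : lam 1 / lam 0 * lam 0 = lam 1 := by field_simp
        simp only [zero_le, max_eq_right]
        nlinarith [mul_pos p1 h0, mul_pos p2 h1]
      · rw [max_eq_left (show 1 ≤ a from ha)]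
        nlinarith [mul_pos (add_pos p1 p2) (hpos a)]
  refine ⟨ENNReal.ofReal (C₀ ^ 2 * 2 ^ A), A, ENNReal.ofReal_ne_top, fun a b s hs hba hab => ?_⟩
  have hreal : lam b.natAbs ≤ C₀ ^ 2 * 2 ^ A * (s : ℝ) ^ A * lam a.natAbs := by
    calc lam b.natAbs ≤ C₀ * lam (max b.natAbs 1) := hup _
      _ ≤ C₀ * ((2 * s) ^ A * lam (max a.natAbs 1)) := by
          gcongr
          exact hmain _ _ s (le_max_right _ _) (le_max_right _ _) hs hba hab
      _ ≤ C₀ * ((2 * s) ^ A * (C₀ * lam a.natAbs)) := by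
          gcongr
          exact hdown _
      _ = _ := by rw [mul_pow]; ring
  refine (ENNReal.ofReal_le_ofReal hreal).trans_eq ?_
  rw [ENNReal.ofReal_mul (by positivity), ENNReal.ofReal_mul (by positivity),
    ENNReal.ofReal_pow (by positivity), ENNReal.ofReal_natCast]

/-! ### Weighted energy and multiplication by smooth functions -/

/-- The weighted energy `∑ |f̂(n)|² w(n)`, with values in `[0, ∞]`. -/
noncomputable def circleEnergy (w : ℤ → ℝ≥0∞) (f : UnitAddCircle → ℂ) : ℝ≥0∞ :=
  ∑' n : ℤ, ‖fourierCoeff f n‖ₑ ^ 2 * w n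

lemma fourierCoeff_fourier_mul (h : UnitAddCircle → ℂ) (m n : ℤ) :
    fourierCoeff (fun x => fourier m x * h x) n = fourierCoeff h (n - m) := by
  unfold fourierCoeff
  congr 1
  funext x
  rw [smul_eq_mul, smul_eq_mul, ← mul_assoc, ← fourier_add]
  congr 2
  ring_nf

/-- Multiplication by a smooth function is bounded on the weighted space: its Fourier coefficients
decay fast enough to absorb the growth of the weight under translation. -/
lemma CircleSmooth.exists_energy_mul_le {w : ℤ → ℝ≥0∞} {K : ℝ≥0∞} {A : ℕ} (hK : K ≠ ∞)
    (hw : ModerateGrowth w K A) {f : UnitAddCircle → ℂ} (hf : CircleSmooth f) :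
    ∃ M : ℝ≥0∞, M ≠ ∞ ∧ ∀ h : UnitAddCircle → ℂ, Continuous h →
      circleEnergy w (fun x => f x * h x) ≤ M * circleEnergy w h := by
  set p : ℤ → ℝ≥0∞ := fun m => ‖fourierCoeff f m‖ₑ with hp
  refine ⟨(∑' m, p m) * (∑' m, p m * (1 + (m.natAbs : ℝ≥0∞)) ^ A) * K,
    ENNReal.mul_ne_top (ENNReal.mul_ne_top ?_ (hf.tsum_weighted_ne_top A)) hK, fun h hh => ?_⟩
  · simpa using hf.tsum_weighted_ne_top 0
  obtain ⟨B, hB⟩ := hh.exists_norm_le_circle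
  have hcoeff : ∀ n, ‖fourierCoeff (fun x => f x * h x) n‖ₑ ≤
      ∑' m, p m * ‖fourierCoeff h (n - m)‖ₑ := fun n => by
    have := enorm_fourierCoeff_le_tsum (f := fun x => f x * h x)
      (u := fun m x => fourier m x * h x) (M := B) hf.summable
      (fun m => (map_continuous _).mul hh)
      (fun m x => by rw [norm_mul, norm_fourier_apply, one_mul]; exact hB x)
      (fun x => by simpa only [mul_assoc] using (hf.hasSum x).mul_right (h x)) n
    simpa only [fourierCoeff_fourier_mul] using this
  have hshift : ∀ m, ∑' n, ‖fourierCoeff h (n - m)‖ₑ ^ 2 * w n ≤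
      K * (1 + (m.natAbs : ℝ≥0∞)) ^ A * circleEnergy w h := fun m => by
    rw [← (Equiv.addRight m).tsum_eq, circleEnergy, ← ENNReal.tsum_mul_left]
    refine ENNReal.tsum_le_tsum fun n => ?_
    simp only [Equiv.coe_addRight, add_sub_cancel_right]
    calc _ ≤ ‖fourierCoeff h n‖ₑ ^ 2 * (K * (1 + (m.natAbs : ℝ≥0∞)) ^ A * w n) := by
          gcongr
          exact hw.add_le n m
      _ = _ := by ring
  calc circleEnergy w (fun x => f x * h x)
      ≤ ∑' n, ((∑' m, p m) * ∑' m, p m * ‖fourierCoeff h (n - m)‖ₑ ^ 2) * w n := by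
        refine ENNReal.tsum_le_tsum fun n => ?_
        gcongr
        exact (pow_le_pow_left' (hcoeff n) 2).trans (ENNReal.tsum_mul_sq_le _ _)
    _ = (∑' m, p m) * ∑' m, p m * ∑' n, ‖fourierCoeff h (n - m)‖ₑ ^ 2 * w n := by
        simp only [mul_assoc, ENNReal.tsum_mul_left]
        congr 1
        simp only [← ENNReal.tsum_mul_right, ← ENNReal.tsum_mul_left]
        rw [ENNReal.tsum_comm]
        simp only [mul_assoc]
    _ ≤ (∑' m, p m) * ∑' m, p m * (K * (1 + (m.natAbs : ℝ≥0∞)) ^ A * circleEnergy w h) := by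
        gcongr with m
        exact hshift m
    _ = _ := by
        rw [mul_assoc, mul_assoc]
        congr 1
        rw [← ENNReal.tsum_mul_right]
        exact tsum_congr fun m => by ring

/-! ### Superpositions of dilates -/

lemma CircleSmooth.dilate {φ : UnitAddCircle → ℂ} (hφ : CircleSmooth φ) (n : ℕ)
    (q : UnitAddCircle) : CircleSmooth fun x => φ (n • (x - q)) := by
  obtain ⟨r, rfl⟩ := QuotientAddGroup.mk_surjective q
  have h : ContDiff ℝ (⊤ : ℕ∞) fun t : ℝ => (n : ℝ) * (t - r) :=
    contDiff_const.mul (contDiff_id.sub contDiff_const)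
  have h2 := ContDiff.comp (g := fun t : ℝ => φ (t : UnitAddCircle)) hφ h
  have hcoe : ∀ t : ℝ, (((n : ℝ) * (t - r) : ℝ) : UnitAddCircle) =
      n • ((t : UnitAddCircle) - (r : UnitAddCircle)) := fun t => by
    rw [← nsmul_eq_mul, AddCircle.coe_nsmul, AddCircle.coe_sub]
  simp only [Function.comp_def, hcoe] at h2
  exact h2

lemma enorm_fourierCoeff_fourier_dilate (d m : ℤ) (n : ℕ) (q : UnitAddCircle) :
    ‖fourierCoeff (fun x : UnitAddCircle => fourier d (n • (x - q))) m‖ₑ =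
      if d * n = m then 1 else 0 := by
  have h : (fun x : UnitAddCircle => (fourier d (n • (x - q)) : ℂ)) =
      fun x => fourier (d * n) (-q) * fourier (d * n) x := by
    funext x
    simp only [fourier_apply]
    rw [← Circle.coe_mul, ← toCircle_add, ← smul_add, neg_add_eq_sub, mul_smul, natCast_zsmul]
  rw [h, fourierCoeff.const_mul, enorm_mul, fourierCoeff_fourier]
  have h1 : ‖(fourier (d * n) (-q) : ℂ)‖ₑ = 1 := by
    rw [← ofReal_norm, norm_fourier_apply, ENNReal.ofReal_one]
  rw [h1, one_mul, Pi.single_apply]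
  by_cases hm : d * n = m
  · simp [hm]
  · rw [if_neg hm, if_neg (Ne.symm hm)]
    simp

lemma enorm_fourierCoeff_dilate_le {φ : UnitAddCircle → ℂ} (hφ : CircleSmooth φ) (n : ℕ)
    (q : UnitAddCircle) (m : ℤ) :
    ‖fourierCoeff (fun x => φ (n • (x - q))) m‖ₑ ≤
      ∑' d : ℤ, ‖fourierCoeff φ d‖ₑ * if d * n = m then 1 else 0 := by
  have := enorm_fourierCoeff_le_tsum (f := fun x => φ (n • (x - q)))
    (u := fun d x => fourier d (n • (x - q))) (M := 1) hφ.summable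
    (fun d => by fun_prop) (fun d x => (norm_fourier_apply _ _).le)
    (fun x => hφ.hasSum _) m
  simpa only [enorm_fourierCoeff_fourier_dilate] using this

/-- A sum with at most one nonzero term may be squared term by term. -/
lemma sq_sum_ite_le {ι : Type*} (s : Finset ι) (c : ι → ℝ≥0∞) (P : ι → Prop) [DecidablePred P]
    (hP : ∀ i j, P i → P j → i = j) :
    (∑ i ∈ s, c i * if P i then 1 else 0) ^ 2 ≤ ∑ i ∈ s, c i ^ 2 * if P i then 1 else 0 := by
  by_cases h : ∃ i ∈ s, P i
  · obtain ⟨i, hi, hPi⟩ := h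
    rw [Finset.sum_eq_single_of_mem i hi fun j _ hj => by
      rw [if_neg fun hPj => hj (hP j i hPj hPi), mul_zero]]
    refine le_trans ?_ (Finset.single_le_sum (fun _ _ => zero_le) hi)
    simp [hPi]
  · push Not at h
    rw [Finset.sum_eq_zero fun i hi => by rw [if_neg (h i hi), mul_zero]]
    simp

/-- The energy of a superposition of dilates `∑ c_n φ(n (x - q))`. The frequency `d * n` with
`d ≠ 0` only sees the weight at `n`, up to a power of `d` that the decay of `φ̂` absorbs; for a
fixed `d` different `n` contribute to different frequencies, so that the coefficients add up in
the square. -/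
lemma CircleSmooth.energy_sum_dilate_le {w : ℤ → ℝ≥0∞} {K : ℝ≥0∞} {A : ℕ}
    (hw : ModerateGrowth w K A) {φ : UnitAddCircle → ℂ} (hφ : CircleSmooth φ)
    (q : UnitAddCircle) (c : ℕ → ℂ) (s : Finset ℕ) (hs : ∀ n ∈ s, n ≠ 0) :
    circleEnergy w (fun x => ∑ n ∈ s, c n * φ (n • (x - q))) ≤
      (‖fourierCoeff φ 0‖ₑ * ∑ n ∈ s, ‖c n‖ₑ) ^ 2 * w 0 +
      (∑' d, ‖fourierCoeff φ d‖ₑ) *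
        ((∑' d, ‖fourierCoeff φ d‖ₑ * (1 + (d.natAbs : ℝ≥0∞)) ^ A) *
          (K * ∑ n ∈ s, ‖c n‖ₑ ^ 2 * w n)) := by
  set p : ℤ → ℝ≥0∞ := fun d => ‖fourierCoeff φ d‖ₑ with hp
  set h : UnitAddCircle → ℂ := fun x => ∑ n ∈ s, c n * φ (n • (x - q)) with hh
  have hcoeff : ∀ m, ‖fourierCoeff h m‖ₑ ≤
      ∑' d, p d * ∑ n ∈ s, ‖c n‖ₑ * if d * n = m then 1 else 0 := fun m => by
    have h1 : fourierCoeff h m = ∑ n ∈ s, c n * fourierCoeff (fun x => φ (n • (x - q))) m := by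
      have h2 := fourierCoeff.sum s (fun n x => c n * φ (n • (x - q))) fun n _ =>
        (continuous_const.mul (hφ.dilate n q).continuous).integrable_circle
      have h3 : h = ∑ n ∈ s, fun x => c n * φ (n • (x - q)) := by
        funext x
        simp [hh, Finset.sum_apply]
      rw [h3, h2, Finset.sum_apply]
      exact Finset.sum_congr rfl fun n _ => fourierCoeff.const_mul _ _ _
    calc ‖fourierCoeff h m‖ₑ
        ≤ ∑ n ∈ s, ‖c n‖ₑ * ‖fourierCoeff (fun x => φ (n • (x - q))) m‖ₑ := by
          rw [h1]
          refine (enorm_sum_le _ _).trans_eq ?_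
          simp only [enorm_mul]
      _ ≤ ∑ n ∈ s, ‖c n‖ₑ * ∑' d, p d * if d * n = m then 1 else 0 := by
          gcongr with n
          exact enorm_fourierCoeff_dilate_le hφ n q m
      _ = _ := by
          simp only [← ENNReal.tsum_mul_left, Finset.mul_sum]
          rw [Summable.tsum_finsetSum fun _ _ => ENNReal.summable]
          exact Finset.sum_congr rfl fun n _ => tsum_congr fun d => mul_left_comm _ _ _
  -- Only `d = 0` contributes at the frequency `m = 0`, and it contributes nowhere else.
  have hterm : ∀ m, ‖fourierCoeff h m‖ₑ ^ 2 * w m ≤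
      (if m = 0 then (p 0 * ∑ n ∈ s, ‖c n‖ₑ) ^ 2 * w 0 else 0) +
      (∑' d, p d) * ∑' d, p d * ∑ n ∈ s, if d * n = m then
        (if d = 0 then 0 else ‖c n‖ₑ ^ 2 * w (d * n)) else 0 := fun m => by
    rcases eq_or_ne m 0 with rfl | hm
    · refine le_add_right ?_
      rw [if_pos rfl]
      gcongr
      refine (hcoeff 0).trans_eq ?_
      rw [tsum_eq_single 0]
      · simp
      · intro d hd
        rw [Finset.sum_eq_zero fun n hn => ?_, mul_zero]
        rw [if_neg (mul_ne_zero hd (Nat.cast_ne_zero.2 (hs n hn))), mul_zero]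
    · rw [if_neg hm, zero_add]
      calc ‖fourierCoeff h m‖ₑ ^ 2 * w m
          ≤ ((∑' d, p d) * ∑' d, p d *
              (∑ n ∈ s, ‖c n‖ₑ * if d * n = m then 1 else 0) ^ 2) * w m := by
            gcongr
            exact (pow_le_pow_left' (hcoeff m) 2).trans (ENNReal.tsum_mul_sq_le _ _)
        _ = (∑' d, p d) * ∑' d, p d *
              ((∑ n ∈ s, ‖c n‖ₑ * if d * n = m then 1 else 0) ^ 2 * w m) := by
            rw [mul_assoc]
            congr 1
            rw [← ENNReal.tsum_mul_right]
            exact tsum_congr fun d => mul_assoc _ _ _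
        _ ≤ _ := by
            gcongr with d
            rcases eq_or_ne d 0 with rfl | hd
            · simp [Ne.symm hm]
            · calc _ ≤ (∑ n ∈ s, ‖c n‖ₑ ^ 2 * if d * n = m then 1 else 0) * w m := by
                    gcongr
                    refine sq_sum_ite_le s _ _ fun i j hi hj => ?_
                    exact Nat.cast_injective (mul_left_cancel₀ hd (hi.trans hj.symm))
                _ = _ := by
                    rw [Finset.sum_mul]
                    refine Finset.sum_congr rfl fun n _ => ?_
                    by_cases hdn : d * n = m
                    · simp [hdn, hd]
                    · simp [hdn]
  calc circleEnergy w h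
      ≤ _ := ENNReal.tsum_le_tsum hterm
    _ = (p 0 * ∑ n ∈ s, ‖c n‖ₑ) ^ 2 * w 0 +
        (∑' d, p d) * ∑' d, p d * ∑ n ∈ s,
          (if d = 0 then 0 else ‖c n‖ₑ ^ 2 * w (d * n)) := by
        rw [ENNReal.tsum_add, tsum_ite_eq 0 fun _ => (p 0 * ∑ n ∈ s, ‖c n‖ₑ) ^ 2 * w 0,
          ENNReal.tsum_mul_left, ENNReal.tsum_comm]
        congr 2
        refine tsum_congr fun d => ?_
        rw [ENNReal.tsum_mul_left, Summable.tsum_finsetSum fun _ _ => ENNReal.summable]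
        congr 1
        refine Finset.sum_congr rfl fun n _ => ?_
        simp only [eq_comm (a := d * (n : ℤ))]
        rw [tsum_ite_eq (d * (n : ℤ)) fun _ => if d = 0 then 0 else ‖c n‖ₑ ^ 2 * w (d * n)]
    _ ≤ _ := by
        refine add_le_add le_rfl (mul_le_mul_right ?_ _)
        rw [← ENNReal.tsum_mul_right]
        refine ENNReal.tsum_le_tsum fun d => ?_
        rw [mul_assoc]
        refine mul_le_mul_right ?_ _
        rw [Finset.mul_sum, Finset.mul_sum]
        refine Finset.sum_le_sum fun n hn => ?_
        rcases eq_or_ne d 0 with rfl | hd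
        · simp
        · rw [if_neg hd]
          calc _ ≤ ‖c n‖ₑ ^ 2 * (K * (1 + (d.natAbs : ℝ≥0∞)) ^ A * w n) := by
                gcongr
                exact hw.mul_le hd (Nat.cast_ne_zero.2 (hs n hn))
            _ = _ := by ring

/-! ### Cut-off functions of small energy -/

lemma re_fourier_one_coe (t : ℝ) :
    (fourier 1 (t : UnitAddCircle)).re = Real.cos (2 * Real.pi * t) := by
  rw [fourier_coe_apply, ← Complex.exp_ofReal_mul_I_re]
  congr 2
  push_cast
  ring

/-- Smooth cut-off functions at `0` with values in `[0, 1]` and arbitrarily small mean. -/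
lemma exists_bump {ε : ℝ} (hε : 0 < ε) :
    ∃ φ : UnitAddCircle → ℝ, CircleSmooth (fun x => (φ x : ℂ)) ∧ (∀ x, 0 ≤ φ x) ∧
      (∀ x, φ x ≤ 1) ∧ (∀ᶠ x in 𝓝 (0 : UnitAddCircle), φ x = 1) ∧
      ‖fourierCoeff (fun x => (φ x : ℂ)) 0‖ ≤ ε := by
  -- Here `(fourier 1 x).re` is `cos (2πx)`, so the argument of the transition function is `2` at
  -- `x = 0`, and it becomes negative as `k → ∞` everywhere else.
  set φ : ℕ → UnitAddCircle → ℝ := fun k x =>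
    Real.smoothTransition (2 - k * (1 - (fourier 1 x).re)) with hφ
  have hlift : ∀ k (t : ℝ), φ k (t : UnitAddCircle) =
      Real.smoothTransition (2 - k * (1 - Real.cos (2 * Real.pi * t))) := fun k t => by
    simp only [hφ, re_fourier_one_coe]
  have hsm : ∀ k, CircleSmooth fun x => (φ k x : ℂ) := fun k => by
    simp only [CircleSmooth, hlift]
    refine Complex.ofRealCLM.contDiff.comp (Real.smoothTransition.contDiff.comp ?_)
    fun_prop
  have hlim : Tendsto (fun k => fourierCoeff (fun x => (φ k x : ℂ)) 0) atTop (𝓝 0) := by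
    simp only [fourierCoeff_eq_intervalIntegral _ 0 0, neg_zero, fourier_zero, one_smul, div_one,
      zero_add]
    have h0 : (0 : ℂ) = ∫ _ in (0 : ℝ)..1, (0 : ℂ) := by simp
    rw [h0]
    refine intervalIntegral.tendsto_integral_filter_of_dominated_convergence (fun _ => 1)
      (.of_forall fun k => ?_) (.of_forall fun k => ae_of_all _ fun t _ => ?_)
      intervalIntegrable_const ?_
    · exact (ContDiff.continuous (hsm k)).aestronglyMeasurable
    · rw [Complex.norm_real, Real.norm_of_nonneg (Real.smoothTransition.nonneg _)]
      exact Real.smoothTransition.le_one _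
    · have h1 : ∀ᵐ t : ℝ, t ≠ 1 := Measure.ae_ne volume 1
      filter_upwards [h1] with t ht1 ht
      rw [Set.uIoc_of_le zero_le_one] at ht
      have hcos : Real.cos (2 * Real.pi * t) < 1 := by
        refine lt_of_le_of_ne (Real.cos_le_one _) fun h => ?_
        obtain ⟨n, hn⟩ := (Real.cos_eq_one_iff _).1 h
        have hnt : (n : ℝ) = t := by
          have := Real.pi_pos
          field_simp at hn
          linarith
        have hn0 : 0 < n := by exact_mod_cast hnt ▸ ht.1
        have hn1 : n < 1 := by exact_mod_cast hnt ▸ lt_of_le_of_ne ht.2 ht1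
        omega
      obtain ⟨k₀, hk₀⟩ := exists_nat_ge (2 / (1 - Real.cos (2 * Real.pi * t)))
      refine tendsto_const_nhds.congr' ?_
      filter_upwards [eventually_ge_atTop k₀] with k hk
      have hk' : (k₀ : ℝ) ≤ k := by exact_mod_cast hk
      rw [hlift, Real.smoothTransition.zero_of_nonpos, Complex.ofReal_zero]
      rw [div_le_iff₀ (by linarith)] at hk₀
      nlinarith
  obtain ⟨k, hk⟩ := (((tendsto_norm_zero.comp hlim).eventually (ge_mem_nhds hε))).exists
  refine ⟨φ k, hsm k, fun x => Real.smoothTransition.nonneg _,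
    fun x => Real.smoothTransition.le_one _, ?_, hk⟩
  have hc : Continuous fun x : UnitAddCircle => 2 - k * (1 - (fourier 1 x).re) := by fun_prop
  have h2 : (1 : ℝ) < 2 - k * (1 - (fourier 1 (0 : UnitAddCircle)).re) := by simp
  filter_upwards [hc.continuousAt.eventually (lt_mem_nhds h2)] with x hx
  exact Real.smoothTransition.one_of_one_le hx.le

/-- Points have zero capacity: if `∑ 1 / λ_n = ∞`, there are cut-off functions at `q` of
arbitrarily small energy. They are averages of dilates of one fixed bump at the scales `1, …, N`,
with weights proportional to `1 / λ_n`. -/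
lemma exists_cutoff_energy_le {lam : ℕ → ℝ} (hpos : ∀ n, 0 < lam n)
    (hdiv : ¬ Summable (fun n : ℕ => 1 / lam n)) {K : ℝ≥0∞} {A : ℕ} (hK : K ≠ ∞)
    (hw : ModerateGrowth (fun n => ENNReal.ofReal (lam n.natAbs)) K A)
    (q : UnitAddCircle) {η : ℝ} (hη : 0 < η) :
    ∃ h : UnitAddCircle → ℝ, CircleSmooth (fun x => (h x : ℂ)) ∧ (∀ x, 0 ≤ h x) ∧
      (∀ x, h x ≤ 1) ∧ (∀ᶠ x in 𝓝 q, h x = 1) ∧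
      circleEnergy (fun n => ENNReal.ofReal (lam n.natAbs)) (fun x => (h x : ℂ)) ≤
        ENNReal.ofReal η := by
  have hl0 := hpos 0
  obtain ⟨φ, hφ, hφ0, hφ1, hφn, hφm⟩ := exists_bump (ε := √(η / (2 * lam 0))) (by positivity)
  set T : ℝ≥0∞ := (∑' d, ‖fourierCoeff (fun x => (φ x : ℂ)) d‖ₑ) *
    ((∑' d : ℤ, ‖fourierCoeff (fun x => (φ x : ℂ)) d‖ₑ * (1 + (d.natAbs : ℝ≥0∞)) ^ A) * K)
    with hT
  have hTtop : T ≠ ∞ := by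
    refine ENNReal.mul_ne_top ?_ (ENNReal.mul_ne_top (hφ.tsum_weighted_ne_top A) hK)
    simpa using hφ.tsum_weighted_ne_top 0
  -- `S` is large enough to make the oscillating part of the energy, at most `T / S`, small.
  obtain ⟨N, hN⟩ : ∃ N : ℕ, 1 + 2 * T.toReal / η ≤ ∑ n ∈ Finset.Icc 1 N, 1 / lam n := by
    have hdiv' : ¬ Summable (fun n : ℕ => 1 / lam (n + 1)) := fun h =>
      hdiv ((summable_nat_add_iff (f := fun n => 1 / lam n) 1).1 h)
    have h := (not_summable_iff_tendsto_nat_atTop_of_nonneg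
      fun n => (one_div_pos.2 (hpos (n + 1))).le).1 hdiv'
    obtain ⟨N, hN⟩ := (h.eventually_ge_atTop (1 + 2 * T.toReal / η)).exists
    refine ⟨N, hN.trans_eq ?_⟩
    rw [Finset.range_eq_Ico, Finset.sum_Ico_add' (fun n => 1 / lam n) 0 N 1]
    rfl
  set s := Finset.Icc 1 N with hs
  set S := ∑ n ∈ s, 1 / lam n with hS
  have hT0 : 0 ≤ 2 * T.toReal / η := by positivity
  have hS0 : 0 < S := by linarith
  have hs0 : ∀ n ∈ s, n ≠ 0 := fun n hn => by
    have := (Finset.mem_Icc.1 hn).1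
    omega
  set c : ℕ → ℝ := fun n => 1 / lam n / S with hc
  have hc0 : ∀ n, 0 ≤ c n := fun n => by
    have := hpos n
    positivity
  have hcsum : ∑ n ∈ s, c n = 1 := by
    rw [← Finset.sum_div, div_self hS0.ne']
  have hcn : ∀ n, ‖(c n : ℂ)‖ₑ = ENNReal.ofReal (c n) := fun n => by
    rw [← ofReal_norm, Complex.norm_real, Real.norm_of_nonneg (hc0 n)]
  have hcast : (fun x => ((∑ n ∈ s, c n * φ (n • (x - q)) : ℝ) : ℂ)) =
      fun x => ∑ n ∈ s, (c n : ℂ) * (φ (n • (x - q)) : ℂ) := by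
    funext x
    push_cast
    rfl
  refine ⟨fun x => ∑ n ∈ s, c n * φ (n • (x - q)), ?_, fun x => ?_, fun x => ?_, ?_, ?_⟩
  · rw [hcast]
    exact ContDiff.sum fun n _ => contDiff_const.mul (hφ.dilate n q)
  · exact Finset.sum_nonneg fun n _ => mul_nonneg (hc0 n) (hφ0 _)
  · exact (Finset.sum_le_sum fun n _ =>
      mul_le_of_le_one_right (hc0 n) (hφ1 _)).trans_eq hcsum
  · have h1 : ∀ᶠ x in 𝓝 q, ∀ n ∈ s, φ (n • (x - q)) = 1 := by
      refine (Filter.eventually_all_finset s).2 fun n _ => ?_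
      have hcont : Tendsto (fun x : UnitAddCircle => n • (x - q)) (𝓝 q) (𝓝 0) := by
        have : Continuous fun x : UnitAddCircle => n • (x - q) := by fun_prop
        simpa using this.tendsto q
      exact hcont.eventually hφn
    filter_upwards [h1] with x hx
    exact (Finset.sum_congr rfl fun n hn => by rw [hx n hn, mul_one]).trans hcsum
  · rw [hcast]
    refine (hφ.energy_sum_dilate_le hw q (fun n => (c n : ℂ)) s hs0).trans ?_
    have hsum1 : ∑ n ∈ s, ‖(c n : ℂ)‖ₑ = 1 := by
      simp only [hcn]
      rw [← ENNReal.ofReal_sum_of_nonneg fun n _ => hc0 n, hcsum, ENNReal.ofReal_one]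
    have hsum2 : ∑ n ∈ s, ‖(c n : ℂ)‖ₑ ^ 2 * ENNReal.ofReal (lam (n : ℤ).natAbs) =
        ENNReal.ofReal (1 / S) := by
      have h1 : ∀ n, ‖(c n : ℂ)‖ₑ ^ 2 * ENNReal.ofReal (lam (n : ℤ).natAbs) =
          ENNReal.ofReal (c n * (1 / S)) := fun n => by
        rw [hcn, ← ENNReal.ofReal_pow (hc0 n), ← ENNReal.ofReal_mul (by positivity),
          Int.natAbs_natCast]
        congr 1
        have := hpos n
        simp only [hc]
        field_simp
      simp only [h1]
      rw [← ENNReal.ofReal_sum_of_nonneg fun n _ => mul_nonneg (hc0 n) (by positivity),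
        ← Finset.sum_mul, hcsum, one_mul]
    rw [hsum1, hsum2, mul_one, ← add_halves η, ENNReal.ofReal_add (by positivity) (by positivity)]
    refine add_le_add ?_ ?_
    · rw [← ofReal_norm, ← ENNReal.ofReal_pow (norm_nonneg _),
        ← ENNReal.ofReal_mul (by positivity)]
      refine ENNReal.ofReal_le_ofReal ?_
      calc _ ≤ √(η / (2 * lam 0)) ^ 2 * lam 0 := by
            simp only [Int.natAbs_zero]
            gcongr
        _ = η / 2 := by
            rw [Real.sq_sqrt (by positivity)]
            field_simp
    · calc _ = T * ENNReal.ofReal (1 / S) := by rw [hT]; ring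
        _ = ENNReal.ofReal (T.toReal * (1 / S)) := by
            rw [ENNReal.ofReal_mul ENNReal.toReal_nonneg, ENNReal.ofReal_toReal hTtop]
        _ ≤ ENNReal.ofReal (η / 2) := by
            refine ENNReal.ofReal_le_ofReal ?_
            have h1 : 2 * T.toReal / η ≤ S := by linarith
            rw [div_le_iff₀ hη] at h1
            rw [mul_one_div, div_le_iff₀ hS0]
            linarith

/-! ### Cutting out a dense sequence of points -/

/-- A nonnegative smooth function can be made to vanish near `q` by decreasing it at an arbitrarily
small cost in energy. -/
lemma exists_le_vanishing_near {lam : ℕ → ℝ} (hpos : ∀ n, 0 < lam n)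
    (hdiv : ¬ Summable (fun n : ℕ => 1 / lam n)) {K : ℝ≥0∞} {A : ℕ} (hK : K ≠ ∞)
    (hw : ModerateGrowth (fun n => ENNReal.ofReal (lam n.natAbs)) K A)
    {f : UnitAddCircle → ℝ} (hf : CircleSmooth fun x => (f x : ℂ)) (hf0 : ∀ x, 0 ≤ f x)
    (q : UnitAddCircle) {η : ℝ} (hη : 0 < η) :
    ∃ g : UnitAddCircle → ℝ, CircleSmooth (fun x => (g x : ℂ)) ∧ (∀ x, 0 ≤ g x) ∧
      (∀ x, g x ≤ f x) ∧ (∀ᶠ x in 𝓝 q, g x = 0) ∧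
      circleEnergy (fun n => ENNReal.ofReal (lam n.natAbs)) (fun x => (f x : ℂ) - g x) ≤
        ENNReal.ofReal η := by
  obtain ⟨M, hM, hmul⟩ := hf.exists_energy_mul_le hK hw
  have hη' : 0 < η / (M.toReal + 1) := by positivity
  obtain ⟨h, hh, h0, h1, hq, hE⟩ := exists_cutoff_energy_le hpos hdiv hK hw q hη'
  refine ⟨fun x => f x * (1 - h x), ?_, fun x => mul_nonneg (hf0 x) (sub_nonneg.2 (h1 x)),
    fun x => mul_le_of_le_one_right (hf0 x) (by linarith [h0 x]), ?_, ?_⟩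
  · push_cast
    exact hf.mul (contDiff_const.sub hh)
  · filter_upwards [hq] with x hx
    rw [hx, sub_self, mul_zero]
  · have hfh : (fun x => (f x : ℂ) - ((f x * (1 - h x) : ℝ) : ℂ)) =
        fun x => (f x : ℂ) * (h x : ℂ) := by
      funext x
      push_cast
      ring
    rw [hfh]
    calc _ ≤ M * ENNReal.ofReal (η / (M.toReal + 1)) :=
          (hmul _ hh.continuous).trans (mul_le_mul_right hE M)
      _ = ENNReal.ofReal (M.toReal * (η / (M.toReal + 1))) := by
          rw [ENNReal.ofReal_mul ENNReal.toReal_nonneg, ENNReal.ofReal_toReal hM]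
      _ ≤ ENNReal.ofReal η := by
          refine ENNReal.ofReal_le_ofReal ?_
          rw [mul_div_assoc', div_le_iff₀ (by positivity)]
          nlinarith

/-- A decreasing sequence of smooth functions whose successive terms vanish near the points
`u 0, u 1, …`, at prescribed costs `η j`. -/
lemma exists_seq_vanishing_near {lam : ℕ → ℝ} (hpos : ∀ n, 0 < lam n)
    (hdiv : ¬ Summable (fun n : ℕ => 1 / lam n)) {K : ℝ≥0∞} {A : ℕ} (hK : K ≠ ∞)
    (hw : ModerateGrowth (fun n => ENNReal.ofReal (lam n.natAbs)) K A)
    (u : ℕ → UnitAddCircle) {η : ℕ → ℝ} (hη : ∀ j, 0 < η j) :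
    ∃ F : ℕ → UnitAddCircle → ℝ, (∀ x, F 0 x = 1) ∧ (∀ j, Continuous (F j)) ∧
      (∀ j x, 0 ≤ F j x) ∧ (∀ j x, F (j + 1) x ≤ F j x) ∧
      (∀ j, ∀ᶠ x in 𝓝 (u j), F (j + 1) x = 0) ∧
      ∀ j, circleEnergy (fun n => ENNReal.ofReal (lam n.natAbs))
        (fun x => (F j x : ℂ) - F (j + 1) x) ≤ ENNReal.ofReal (η j) := by
  choose! next hsm h0 hle hq hE using
    fun (j : ℕ) (f : UnitAddCircle → ℝ)
      (hf : CircleSmooth (fun x => (f x : ℂ)) ∧ ∀ x, 0 ≤ f x) =>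
      exists_le_vanishing_near hpos hdiv hK hw hf.1 hf.2 (u j) (hη j)
  obtain ⟨F, hF0, hFs⟩ : ∃ F : ℕ → UnitAddCircle → ℝ,
      (F 0 = fun _ => 1) ∧ ∀ j, F (j + 1) = next j (F j) :=
    ⟨fun j => Nat.rec (fun _ => 1) (fun j f => next j f) j, rfl, fun _ => rfl⟩
  have hF : ∀ j, CircleSmooth (fun x => ((F j x : ℝ) : ℂ)) ∧ ∀ x, 0 ≤ F j x := fun j => by
    induction j with
    | zero =>
      rw [hF0]
      exact ⟨contDiff_const, fun _ => zero_le_one⟩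
    | succ j ih =>
      rw [hFs]
      exact ⟨hsm j _ ih, h0 j _ ih⟩
  refine ⟨F, fun x => congrFun hF0 x, fun j => ?_, fun j => (hF j).2, fun j => ?_, fun j => ?_,
    fun j => ?_⟩
  · exact Complex.continuous_re.comp (hF j).1.continuous
  all_goals rw [hFs]
  · exact hle j _ (hF j)
  · exact hq j _ (hF j)
  · exact hE j _ (hF j)

/-- Minkowski's inequality for a series in a weighted `ℓ²` space, with summable bounds `δ j` on the
norms of the terms. -/
lemma tsum_sq_mul_le_of_le_tsum {w : ℤ → ℝ≥0∞} {e : ℤ → ℝ≥0∞} {d : ℕ → ℤ → ℝ≥0∞}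
    {δ : ℕ → ℝ≥0∞} {B : ℝ≥0∞} (he : ∀ n, e n ≤ ∑' j, d j n) (hδ0 : ∀ j, δ j ≠ 0)
    (hδ : ∀ j, δ j ≠ ∞) (hd : ∀ j, ∑' n, d j n ^ 2 * w n ≤ B * δ j ^ 2) :
    ∑' n, e n ^ 2 * w n ≤ B * (∑' j, δ j) ^ 2 := by
  calc ∑' n, e n ^ 2 * w n
      ≤ ∑' n, ((∑' j, δ j) * ∑' j, δ j * ((δ j)⁻¹ * d j n) ^ 2) * w n := by
        refine ENNReal.tsum_le_tsum fun n => mul_le_mul_left ?_ _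
        refine le_trans (pow_le_pow_left' ((he n).trans_eq ?_) 2) (ENNReal.tsum_mul_sq_le _ _)
        refine tsum_congr fun j => ?_
        rw [← mul_assoc, ENNReal.mul_inv_cancel (hδ0 j) (hδ j), one_mul]
    _ = (∑' j, δ j) * ∑' j, δ j * (((δ j)⁻¹) ^ 2 * ∑' n, d j n ^ 2 * w n) := by
        simp only [mul_assoc, ENNReal.tsum_mul_left, mul_pow]
        congr 1
        simp only [← ENNReal.tsum_mul_right, ← ENNReal.tsum_mul_left]
        rw [ENNReal.tsum_comm]
        simp only [mul_assoc]
    _ ≤ (∑' j, δ j) * ∑' j, δ j * B := by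
        refine mul_le_mul_right (ENNReal.tsum_le_tsum fun j => mul_le_mul_right ?_ _) _
        refine (mul_le_mul_right (hd j) _).trans_eq ?_
        rw [mul_left_comm, ← mul_pow, ENNReal.inv_mul_cancel (hδ0 j) (hδ j), one_pow, mul_one]
    _ = _ := by
        rw [ENNReal.tsum_mul_right]
        ring

lemma fourierCoeff_sub {f g : UnitAddCircle → ℂ} (hf : Integrable f haarAddCircle)
    (hg : Integrable g haarAddCircle) (n : ℤ) :
    fourierCoeff (fun x => f x - g x) n = fourierCoeff f n - fourierCoeff g n := by
  unfold fourierCoeff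
  rw [← integral_sub (hf.fourier_smul (-n)) (hg.fourier_smul (-n))]
  simp only [smul_sub]

/-! ### The limit function -/

theorem mainTheorem2 (lam : ℕ → ℝ) (hpos : ∀ n, 0 < lam n)
    (hdiv : ¬ Summable (fun n : ℕ => 1 / lam n))
    (hdoubling : ∃ C : ℝ, 1 < C ∧ ∀ n : ℕ, 1 ≤ n → ∀ k : ℕ, n ≤ k → k ≤ 2 * n →
      C⁻¹ * lam n ≤ lam k ∧ lam k ≤ C * lam n) :
    ∃ f : UnitAddCircle → ℝ,
      MemLp f ∞ (haarAddCircle : Measure UnitAddCircle) ∧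
      (∀ᵐ x ∂(haarAddCircle : Measure UnitAddCircle), 0 ≤ f x) ∧
      ¬ (∀ᵐ x ∂(haarAddCircle : Measure UnitAddCircle), f x = 0) ∧
      interior ((haarAddCircle : Measure UnitAddCircle).withDensity
        (fun x => ENNReal.ofReal (f x))).support = ∅ ∧
      Summable (fun n : ℤ =>
        ‖fourierCoeff (fun x : UnitAddCircle => (f x : ℂ)) n‖ ^ 2 * lam n.natAbs) := by
  obtain ⟨K, A, hK, hw⟩ := exists_moderateGrowth hpos hdoubling
  obtain ⟨u, hu⟩ := TopologicalSpace.exists_dense_seq UnitAddCircle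
  -- The costs `λ₀ δ_j²` with `∑ δ_j = 1 / 2` keep the energy of `f - 1` below `λ₀ / 4`, for the
  -- limit `f`, so that its mean is at least `1 / 2`.
  set δ : ℕ → ℝ := fun j => 1 / 2 / 2 / 2 ^ j with hδ
  have hδ0 : ∀ j, 0 < δ j := fun j => by positivity
  have hδsum : HasSum δ (1 / 2) := hasSum_geometric_two' (1 / 2)
  obtain ⟨F, hF1, hFc, hF0, hFle, hFu, hFE⟩ :=
    exists_seq_vanishing_near hpos hdiv hK hw u (η := fun j => lam 0 * δ j ^ 2)
      fun j => mul_pos (hpos 0) (pow_pos (hδ0 j) 2)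
  have hanti : ∀ x, Antitone fun j => F j x := fun x => antitone_nat_of_succ_le fun j => hFle j x
  have hF1' : ∀ j x, F j x ≤ 1 := fun j x => (hanti x (Nat.zero_le j)).trans_eq (hF1 x)
  have hbdd : ∀ x, BddBelow (Set.range fun j => F j x) := fun x =>
    ⟨0, by rintro _ ⟨j, rfl⟩; exact hF0 j x⟩
  set f : UnitAddCircle → ℝ := fun x => ⨅ j, F j x with hf
  have hlim : ∀ x, Tendsto (fun j => F j x) atTop (𝓝 (f x)) := fun x =>
    tendsto_atTop_ciInf (hanti x) (hbdd x)
  have hf0 : ∀ x, 0 ≤ f x := fun x => le_ciInf fun j => hF0 j x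
  have hfle : ∀ j x, f x ≤ F j x := fun j x => ciInf_le (hbdd x) j
  have hfm : Measurable f := Measurable.iInf fun j => (hFc j).measurable
  have hFcc : ∀ j, Continuous fun x => (F j x : ℂ) := fun j =>
    Complex.continuous_ofReal.comp (hFc j)
  have hcoeff : ∀ n, Tendsto (fun j => fourierCoeff (fun x => (F j x : ℂ)) n) atTop
      (𝓝 (fourierCoeff (fun x => (f x : ℂ)) n)) := fun n => by
    refine tendsto_integral_of_dominated_convergence (fun _ => 1) (fun j => ?_)
      (integrable_const _) (fun j => ae_of_all _ fun x => ?_) (ae_of_all _ fun x => ?_)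
    · exact ((map_continuous (fourier (-n))).smul (hFcc j)).aestronglyMeasurable
    · rw [norm_smul, norm_fourier_apply, one_mul, Complex.norm_real,
        Real.norm_of_nonneg (hF0 j x)]
      exact hF1' j x
    · exact ((Complex.continuous_ofReal.tendsto _).comp (hlim x)).const_smul _
  -- The coefficients of `f` differ from those of `F 0 = 1` by little in the weighted norm.
  set e : ℤ → ℝ≥0∞ := fun n =>
    ‖fourierCoeff (fun x => (f x : ℂ)) n - fourierCoeff (fun x => (F 0 x : ℂ)) n‖ₑ with he
  -- Telescoping, and passing to the limit.
  have hle : ∀ n, e n ≤ ∑' j, ‖fourierCoeff (fun x => (F j x : ℂ) - F (j + 1) x) n‖ₑ := by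
    intro n
    refine le_of_tendsto ((hcoeff n).sub_const _).enorm (.of_forall fun J => ?_)
    refine le_trans ?_ (ENNReal.sum_le_tsum (Finset.range J))
    rw [← Finset.sum_range_sub (fun j => fourierCoeff (fun x => (F j x : ℂ)) n)]
    refine (enorm_sum_le _ _).trans_eq (Finset.sum_congr rfl fun j _ => ?_)
    rw [fourierCoeff_sub (hFcc j).integrable_circle (hFcc (j + 1)).integrable_circle, ← enorm_neg,
      neg_sub]
  have hE : ∑' n, e n ^ 2 * ENNReal.ofReal (lam n.natAbs) ≤
      ENNReal.ofReal (lam 0 * (1 / 2) ^ 2) := by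
    refine (tsum_sq_mul_le_of_le_tsum (B := ENNReal.ofReal (lam 0))
      (δ := fun j => ENNReal.ofReal (δ j)) hle (fun j => (ENNReal.ofReal_pos.2 (hδ0 j)).ne')
      (fun j => ENNReal.ofReal_ne_top) fun j => (hFE j).trans_eq ?_).trans_eq ?_
    · rw [ENNReal.ofReal_mul (hpos 0).le, ENNReal.ofReal_pow (hδ0 j).le]
    · rw [← ENNReal.ofReal_tsum_of_nonneg (fun j => (hδ0 j).le) hδsum.summable, hδsum.tsum_eq,
        ENNReal.ofReal_mul (hpos 0).le, ENNReal.ofReal_pow (by norm_num)]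
  have hone : ∀ n, fourierCoeff (fun x => (F 0 x : ℂ)) n = if n = 0 then 1 else 0 := fun n => by
    have h1 : (fun x => (F 0 x : ℂ)) = ⇑(fourier 0 : C(UnitAddCircle, ℂ)) := by
      funext x
      simp [hF1]
    rw [h1, fourierCoeff_fourier, Pi.single_apply]
  refine ⟨f, ?_, ae_of_all _ hf0, fun hzero => ?_, ?_, ?_⟩
  · refine memLp_top_of_bound hfm.aestronglyMeasurable 1 (ae_of_all _ fun x => ?_)
    rw [Real.norm_of_nonneg (hf0 x)]
    exact (hfle 0 x).trans (hF1' 0 x)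
  · -- If `f = 0` almost everywhere, the frequency `0` alone contributes `λ₀` to the energy of
    -- `f - 1`.
    have hc0 : fourierCoeff (fun x => (f x : ℂ)) 0 = 0 := by
      refine integral_eq_zero_of_ae ?_
      filter_upwards [hzero] with x hx
      simp [hx]
    have h1 : ENNReal.ofReal (lam 0) ≤ ENNReal.ofReal (lam 0 * (1 / 2) ^ 2) := by
      refine le_trans ?_ ((ENNReal.le_tsum (0 : ℤ)).trans hE)
      simp [he, hc0, hone]
    have h2 := (ENNReal.ofReal_le_ofReal_iff (by have := hpos 0; positivity)).1 h1
    linarith [hpos 0]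
  · by_contra hne
    obtain ⟨x, hx, j, rfl⟩ :=
      hu.inter_open_nonempty _ isOpen_interior (Set.nonempty_iff_ne_empty.2 hne)
    refine Measure.notMem_support_iff_exists.2 ⟨{x | F (j + 1) x = 0}, hFu j, ?_⟩
      (interior_subset hx)
    have hmeas : MeasurableSet {x | F (j + 1) x = 0} :=
      (isClosed_eq (hFc (j + 1)) continuous_const).measurableSet
    rw [withDensity_apply _ hmeas, setLIntegral_congr_fun hmeas (g := fun _ => 0), lintegral_zero]
    intro x hx
    exact ENNReal.ofReal_eq_zero.2 ((hfle (j + 1) x).trans_eq hx)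
  · have hs : Summable fun n : ℤ => (e n ^ 2 * ENNReal.ofReal (lam n.natAbs)).toReal :=
      ENNReal.summable_toReal (ne_top_of_le_ne_top ENNReal.ofReal_ne_top hE)
    refine hs.congr_cofinite ?_
    filter_upwards [(Set.finite_singleton (0 : ℤ)).compl_mem_cofinite] with n hn
    have hn0 : n ≠ 0 := by simpa using hn
    simp [he, hone, hn0, ENNReal.toReal_ofReal (hpos _).le]
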